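/- Let $K$ be a field of characteristic zero, let $L/K$ be a finite (hence separable) extension of fields, let $E$ be the Galois closure of $L/K$, and put $G=\mathrm{Gal}(E/K)$, $G_L=\mathrm{Gal}(E/L)$ and $X=G/G_L$ (left cosets). Let $\lambda:G\to\mathrm{Perm}(X)$ be given by $\lambda(\sigma)(\tau G_L)=\sigma\tau G_L$, and let $G$ act on $\mathrm{Perm}(X)$ by $\sigma*\eta=\lambda(\sigma)\,\eta\,\lambda(\sigma)^{-1}$. Let $N$ be an abelian group and, for $i=1,2$, let $\alpha_i:N\to\mathrm{Perm}(X)$ be an injective homomorphism whose image is $G$-stable and regular (that is, $|\alpha_i(N)|=|X|$ and $\alpha_i(N)$ acts transitively on $X$). Let $E[\alpha_i(N)]^G$ be the $K$-algebra of fixed points of the group algebra $E[\alpha_i(N)]$ under the simultaneous action of $G$ on $E$ as Galois automorphisms and on $\alpha_i(N)$ by $*$. Let $\mathrm{Hol}(N)$ be the normalizer in $\mathrm{Perm}(N)$ of the group of left translations of $N$; then $\mathrm{Hol}(N)=\rho(N)\rtimes\mathrm{Aut}(N)$, where $\rho(x)[y]=yx^{-1}$. Let $\beta_i:G\to\mathrm{Hol}(N)$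 be the homomorphism corresponding to $\alpha_i$ under Byott's translation, that is, $\beta_i(g)=a_i^{-1}\lambda(g)a_i$, where $a_i:N\to X$ is the bijection $a_i(\eta)=\alpha_i(\eta)(1\cdot G_L)$. Let $\overline{\beta_i}:G\to\mathrm{Aut}(N)$ be the composition of $\beta_i$ with the projection of $\mathrm{Hol}(N)$ onto $\mathrm{Aut}(N)$. Let $\zeta$ be a primitive $e$-th root of unity, where $e$ is the exponent of $N$, let $\tilde E$ be the compositum of $E$ and $K(\zeta)$, and let $\Gamma=\mathrm{Gal}(\tilde E/K)$. For $i=1,2$ let $\Gamma$ act on $N$ by $\gamma*_i\eta=\overline{\beta_i}(\gamma|_E)[\eta]$, and on the dual group $\widehat N=\mathrm{Hom}(N,\tilde E^\times)$ by $(\gamma*_i\chi)[\eta]=\gamma\bigl(\chi[\gamma^{-1}*_i\eta]\bigr)$. Then $E[\alpha_1(N)]^G\cong E[\alpha_2(N)]^G$ as $K$-algebras if and only if $(\widehat N,*_1)\cong(\widehat N,*_2)$ as $\Gamma$-sets, i.e. if and only if there is a bijection $\psi:\widehat N\to\widehat N$ with $\psi(\gamma*_1\chi)=\gamma*_2\psi(\chi)$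 for all $\gamma\in\Gamma$ and $\chi\in\widehat N$. -/

import Mathlib

noncomputable section

namespace HopfGalois

open Equiv

/-! ### Regular stable embeddings and Byott's translation -/

/-- The action of `G` on the left coset space `X = G ⧸ H` by left translation,
`σ ↦ (τH ↦ στH)`. -/
def cosetTranslation (G : Type*) [Group G] (H : Subgroup G) : G →* Perm (G ⧸ H) :=
  MulAction.toPermHom G (G ⧸ H)

/-- The left regular representation `x ↦ (y ↦ x * y)`. -/
def leftReg (N : Type*) [Group N] : N →* Perm N :=
  MulAction.toPermHom N N

/-- The right regular representation `x ↦ (y ↦ y * x⁻¹)`. -/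
def rightReg (N : Type*) [Group N] : N →* Perm N where
  toFun x := Equiv.mulRight x⁻¹
  map_one' := by ext y; simp
  map_mul' a b := by ext y; simp [mul_assoc]

/-- A subgroup of `Perm X` is regular if it has the same size as `X` and acts transitively
on `X`. (Used only for finite `X`.) -/
def IsRegularSubgroup {X : Type*} (P : Subgroup (Perm X)) : Prop :=
  Nat.card P = Nat.card X ∧ MulAction.IsPretransitive P X

/-- An embedding of `N` into `Perm (G ⧸ H)` whose image is regular and normalized by the
left translations by elements of `G`. -/
structure RegularStableEmbedding (G : Type*) [Group G] (H : Subgroup G)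
    (N : Type*) [Group N] where
  /-- the underlying homomorphism -/
  hom : N →* Perm (G ⧸ H)
  injective : Function.Injective hom
  regular : IsRegularSubgroup hom.range
  stable : (cosetTranslation G H).range ≤ Subgroup.normalizer (hom.range : Set (Perm (G ⧸ H)))

/-- The holomorph of `N`: the normalizer of the left translations in `Perm N`. -/
def Hol (N : Type*) [Group N] : Subgroup (Perm N) :=
  Subgroup.normalizer ((leftReg N).range : Set (Perm N))

theorem Hol.apply_mul {N : Type*} [Group N] (h : Hol N) (x y : N) :
    (h : Perm N) (x * y) = (h : Perm N) x * ((h : Perm N) 1)⁻¹ * (h : Perm N) y := by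
  obtain ⟨z, hz⟩ := (h.2 (leftReg N x)).1 ⟨x, rfl⟩
  have key : ∀ w, (h : Perm N) (x * w) = z * (h : Perm N) w := by
    intro w
    have := congrArg (fun p : Perm N => p ((h : Perm N) w)) hz
    simpa [leftReg] using this.symm
  have h1 : (h : Perm N) x = z * (h : Perm N) 1 := by simpa using key 1
  rw [key y, h1]; group

/-- The projection `Hol N = ρ(N) ⋊ Aut N → Aut N`, given by the formula
`h ↦ (η ↦ h(η) * h(1)⁻¹)`; see `Hol.eq_rightReg_mul_aut` and `Hol.aut_unique`. -/
def Hol.aut {N : Type*} [Group N] : Hol N →* MulAut N where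
  toFun h := MulEquiv.mk' ((h : Perm N).trans (Equiv.mulRight ((h : Perm N) 1)⁻¹)) (by
    intro x y
    simp only [Equiv.trans_apply, Equiv.coe_mulRight, Hol.apply_mul h x y]
    group)
  map_one' := by
    ext x
    change x * (1 : N)⁻¹ = x
    simp
  map_mul' g h := by
    ext x
    have e : ((h : Perm N) x * ((h : Perm N) 1)⁻¹) * (h : Perm N) 1 = (h : Perm N) x := by group
    have := Hol.apply_mul g ((h : Perm N) x * ((h : Perm N) 1)⁻¹) ((h : Perm N) 1)
    rw [e] at this
    change (g : Perm N) ((h : Perm N) x) * ((g : Perm N) ((h : Perm N) 1))⁻¹ =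
      (g : Perm N) ((h : Perm N) x * ((h : Perm N) 1)⁻¹) * ((g : Perm N) 1)⁻¹
    simp [this]

theorem Hol.aut_apply {N : Type*} [Group N] (h : Hol N) (η : N) :
    Hol.aut h η = (h : Perm N) η * ((h : Perm N) 1)⁻¹ := rfl

/-- Every element of the holomorph is the product of its `ρ(N)`-part and its `Aut N`-part. -/
theorem Hol.eq_rightReg_mul_aut {N : Type*} [Group N] (h : Hol N) :
    (h : Perm N) = rightReg N ((h : Perm N) 1)⁻¹ * MulAut.toPerm N (Hol.aut h) := by
  ext x
  change (h : Perm N) x = Hol.aut h x * ((h : Perm N) 1)⁻¹⁻¹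
  simp [Hol.aut_apply]

/-- The decomposition `Hol N = ρ(N) ⋊ Aut N` determines the automorphism component. -/
theorem Hol.aut_unique {N : Type*} [Group N] (h : Hol N) (x : N) (φ : MulAut N)
    (hφ : (h : Perm N) = rightReg N x * MulAut.toPerm N φ) : Hol.aut h = φ := by
  have key : ∀ z, (h : Perm N) z = φ z * x⁻¹ := by
    intro z; rw [hφ]; rfl
  ext y
  simp [Hol.aut_apply, key]

namespace RegularStableEmbedding

variable {G : Type*} [Group G] {H : Subgroup G} {N : Type*} [Group N]

theorem bijective_apply_base [Finite (G ⧸ H)] (α : RegularStableEmbedding G H N) :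
    Function.Bijective (fun η : N => α.hom η ((1 : G) : G ⧸ H)) := by
  have hc : Nat.card N = Nat.card (G ⧸ H) := by
    rw [← α.regular.1]
    exact Nat.card_congr (MonoidHom.ofInjective α.injective).toEquiv
  have : Finite N := Nat.finite_of_card_ne_zero (by rw [hc]; exact Nat.card_pos.ne')
  refine Function.Surjective.bijective_of_nat_card_le ?_ hc.le
  intro y
  have := α.regular.2
  obtain ⟨⟨_, η, rfl⟩, hg⟩ := MulAction.exists_smul_eq α.hom.range ((1 : G) : G ⧸ H) y
  exact ⟨η, hg⟩

/-- The bijection `N ≃ G ⧸ H`, `η ↦ α(η)(1·H)`, attached to a regular embedding `α`. -/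
def baseEquiv [Finite (G ⧸ H)] (α : RegularStableEmbedding G H N) : N ≃ G ⧸ H :=
  Equiv.ofBijective _ α.bijective_apply_base

theorem baseEquiv_conj [Finite (G ⧸ H)] (α : RegularStableEmbedding G H N) (η : N) :
    α.baseEquiv.symm.permCongr (α.hom η) = leftReg N η := by
  ext x
  simp only [Equiv.permCongr_apply, Equiv.symm_symm]
  rw [Equiv.symm_apply_eq]
  simp [baseEquiv, leftReg]

theorem translate_mem_hol [Finite (G ⧸ H)] (α : RegularStableEmbedding G H N) (g : G) :
    α.baseEquiv.symm.permCongrHom (cosetTranslation G H g) ∈ Hol N := by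
  have hr : ∀ p : Perm (G ⧸ H), p ∈ (α.hom.range : Set (Perm (G ⧸ H))) ↔
      α.baseEquiv.symm.permCongrHom p ∈ ((leftReg N).range : Set (Perm N)) := by
    intro p
    constructor
    · rintro ⟨η, rfl⟩
      exact ⟨η, (α.baseEquiv_conj η).symm⟩
    · rintro ⟨η, hη⟩
      refine ⟨η, α.baseEquiv.symm.permCongrHom.injective ?_⟩
      rw [← hη]
      exact α.baseEquiv_conj η
  intro p
  obtain ⟨q, rfl⟩ := α.baseEquiv.symm.permCongrHom.surjective p
  rw [← hr, ← map_mul, ← map_inv, ← map_mul, ← hr]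
  exact α.stable ⟨g, rfl⟩ q

/-- Byott's translation: the homomorphism `β : G → Hol N` corresponding to the embedding `α`,
obtained by transporting the left translation action of `G` on `G ⧸ H` to `N` along the
bijection `η ↦ α(η)(1·H)`. -/
def beta [Finite (G ⧸ H)] (α : RegularStableEmbedding G H N) : G →* Hol N :=
  (α.baseEquiv.symm.permCongrHom.toMonoidHom.comp (cosetTranslation G H)).codRestrict (Hol N)
    α.translate_mem_hol

/-- The action of `G` on `N` through the automorphism component of `β`. -/
def autAction [Finite (G ⧸ H)] (α : RegularStableEmbedding G H N) : G →* MulAut N :=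
  Hol.aut.comp α.beta

/-- The action of `G` on the image `α(N)` by `σ ∗ η = λ(σ) η λ(σ)⁻¹`. -/
def conjAction (α : RegularStableEmbedding G H N) : G →* MulAut α.hom.range :=
  α.hom.range.normalizerMonoidHom.comp
    ((cosetTranslation G H).codRestrict _ fun g => α.stable ⟨g, rfl⟩)

end RegularStableEmbedding

/-! ### Fixed points of group algebras -/

/-- For an action `f` of `Gal(E/K)` on the group `M` by automorphisms, the action of `σ` on the
group algebra `E[M]`: as a Galois automorphism on the coefficients and via `f` on `M`. -/
def galAct {K E M : Type*} [Field K] [Field E] [Algebra K E] [Group M]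
    (f : Gal(E/K) →* MulAut M) (σ : Gal(E/K)) : MonoidAlgebra E M →ₐ[K] MonoidAlgebra E M :=
  (MonoidAlgebra.domCongr K E (f σ)).toAlgHom.comp
    (MonoidAlgebra.mapAlgHom M (σ : E →ₐ[K] E))

theorem galAct_single {K E M : Type*} [Field K] [Field E] [Algebra K E] [Group M]
    (f : Gal(E/K) →* MulAut M) (σ : Gal(E/K)) (η : M) (x : E) :
    galAct f σ (MonoidAlgebra.single η x) = MonoidAlgebra.single (f σ η) (σ x) := by
  simp [galAct]

/-- The `K`-algebra `E[M]^G`, `G = Gal(E/K)`, of fixed points of the group algebra. -/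
def fixedPoints {K E M : Type*} [Field K] [Field E] [Algebra K E] [Group M]
    (f : Gal(E/K) →* MulAut M) : Subalgebra K (MonoidAlgebra E M) :=
  ⨅ σ : Gal(E/K), AlgHom.equalizer (galAct f σ) (AlgHom.id K (MonoidAlgebra E M))

theorem mem_fixedPoints {K E M : Type*} [Field K] [Field E] [Algebra K E] [Group M]
    (f : Gal(E/K) →* MulAut M) (x : MonoidAlgebra E M) :
    x ∈ fixedPoints f ↔ ∀ σ : Gal(E/K), galAct f σ x = x := by
  simp [fixedPoints, Algebra.mem_iInf]

/-- The Galois group `Gal(E/L)`, as a subgroup of `Gal(E/K)`, for a tower `E/L/K`. -/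
def galSubgroup (K L E : Type*) [Field K] [Field L] [Field E] [Algebra K L] [Algebra K E]
    [Algebra L E] [IsScalarTower K L E] : Subgroup Gal(E/K) :=
  (IsScalarTower.toAlgHom K L E).fieldRange.fixingSubgroup

/-! ### Dual groups and `Γ`-sets -/

/-- The action of `Γ = Gal(F/K)` on the dual group `N →* Fˣ` dual to an action `f` of `Γ`
on `N`: `(γ ∗ χ)(η) = γ (χ (γ⁻¹ ∗ η))`. -/
def dualAction {K F N : Type*} [Field K] [Field F] [Algebra K F] [Group N]
    (f : Gal(F/K) →* MulAut N) : Gal(F/K) →* Perm (N →* Fˣ) :=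
  MonoidHom.toHomPerm
    { toFun := fun γ χ =>
        ((Units.map ((γ : F →ₐ[K] F) : F →* F)).comp χ).comp (f γ⁻¹).toMonoidHom
      map_one' := by
        funext χ; ext η
        change (1 : Gal(F/K)) (χ (f (1 : Gal(F/K))⁻¹ η) : F) = χ η
        simp
      map_mul' := by
        intro γ δ; funext χ; ext η
        change (γ * δ) (χ (f (γ * δ)⁻¹ η) : F) = γ (δ (χ (f δ⁻¹ (f γ⁻¹ η)) : F))
        simp [mul_inv_rev, map_mul] }

theorem dualAction_apply {K F N : Type*} [Field K] [Field F] [Algebra K F] [Group N]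
    (f : Gal(F/K) →* MulAut N) (γ : Gal(F/K)) (χ : N →* Fˣ) (η : N) :
    (dualAction f γ χ η : F) = γ (χ (f γ⁻¹ η) : F) := rfl

/-- Two `Γ`-sets, given by their action homomorphisms, are isomorphic if there is a
`Γ`-equivariant bijection between them. -/
def IsoAsSets {Γ X Y : Type*} [Group Γ] (a : Γ →* Perm X) (b : Γ →* Perm Y) : Prop :=
  ∃ ψ : X ≃ Y, ∀ (γ : Γ) (x : X), ψ (a γ x) = b γ (ψ x)

end HopfGalois

end

/-!
For an abelian group `N` of exponent `e` and a field `F` containing a primitive `e`-th root of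
unity, evaluation at characters is an isomorphism from `F[N]` onto the algebra of functions
`N̂ → F`. If `F ⊇ E` is Galois over `K`, this isomorphism is equivariant for `Γ = Gal(F/K)`, so
that, by Galois descent from `F` to `E`, the algebra `E[N]^G = F[N]^Γ` is the algebra of
`Γ`-equivariant functions `N̂ → F`. By Grothendieck's form of Galois theory a finite `Γ`-set `X`
is recovered from its algebra of equivariant functions `X → F` as the set of `K`-algebra
homomorphisms to `F`.
-/

noncomputable section

namespace HopfGalois

open Equiv

theorem exists_algEquiv_comp_eq_of_ker_le {K F A : Type*} [Field K] [Field F] [Algebra K F]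
    [Normal K F] [CommRing A] [Algebra K A] {φ ψ : A →ₐ[K] F}
    (h : RingHom.ker φ ≤ RingHom.ker ψ) : ∃ γ : Gal(F/K), (γ : F →ₐ[K] F).comp φ = ψ := by
  let M : IntermediateField K F :=
    φ.range.toIntermediateField' (Subalgebra.isField_of_algebraic φ.range)
  let φ' : A →ₐ[K] M := φ.rangeRestrict
  have hφ' : Function.Surjective φ' := φ.rangeRestrict_surjective
  have hker : RingHom.ker φ' ≤ RingHom.ker ψ := fun a ha => h (congrArg Subtype.val ha)
  let g : M →ₐ[K] F := AlgHom.liftOfSurjective φ' hφ' ψ hker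
  refine ⟨AlgEquiv.ofBijective (g.liftNormal F) (Algebra.IsAlgebraic.algHom_bijective _), ?_⟩
  ext a
  exact (g.liftNormal_commutes F (φ' a)).trans (AlgHom.liftOfSurjective_apply φ' hφ' ψ hker a)

/-- A subalgebra contained in the range of an injective homomorphism is isomorphic to its
preimage. -/
def comapEquiv {K A B : Type*} [CommSemiring K] [Semiring A] [Semiring B] [Algebra K A]
    [Algebra K B] {e : A →ₐ[K] B} (he : Function.Injective e) {T : Subalgebra K B}
    (hT : T ≤ e.range) : T.comap e ≃ₐ[K] T :=
  ((T.comap e).equivMapOfInjective e he).trans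
    (Subalgebra.equivOfEq _ _ (Subalgebra.map_comap_eq_self hT))

section EquivariantFunctions

variable {K F X Y : Type*} [Field K] [Field F] [Algebra K F]

/-- The algebra of equivariant functions from a `Gal(F/K)`-set to `F`. -/
def equivariantFunctions (a : Gal(F/K) →* Perm X) : Subalgebra K (X → F) where
  carrier := {φ | ∀ γ x, φ (a γ x) = γ (φ x)}
  mul_mem' h h' γ x := by simp [h γ x, h' γ x]
  add_mem' h h' γ x := by simp [h γ x, h' γ x]
  algebraMap_mem' r γ x := by simp

theorem mem_equivariantFunctions {a : Gal(F/K) →* Perm X} {φ : X → F} :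
    φ ∈ equivariantFunctions a ↔ ∀ γ x, φ (a γ x) = γ (φ x) := Iff.rfl

/-- The point of the algebra of equivariant functions given by evaluation at `x`. -/
def pointEval (a : Gal(F/K) →* Perm X) (x : X) : equivariantFunctions a →ₐ[K] F :=
  (Pi.evalAlgHom K (fun _ => F) x).comp (equivariantFunctions a).val

theorem pointEval_apply (a : Gal(F/K) →* Perm X) (x : X) (φ : equivariantFunctions a) :
    pointEval a x φ = φ.1 x := rfl

theorem pointEval_action (a : Gal(F/K) →* Perm X) (γ : Gal(F/K)) (x : X) :
    pointEval a (a γ x) = (γ : F →ₐ[K] F).comp (pointEval a x) :=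
  AlgHom.ext fun φ => φ.2 γ x

open Classical in
theorem sum_translates_mem_equivariantFunctions [FiniteDimensional K F]
    (a : Gal(F/K) →* Perm X) (x : X) (c : F) :
    (fun y => ∑ γ : Gal(F/K), if a γ x = y then γ c else 0) ∈ equivariantFunctions a := by
  intro δ y
  rw [map_sum]
  refine (Fintype.sum_equiv (Equiv.mulLeft δ) _ _ fun γ => ?_).symm
  simp [apply_ite δ]

theorem pointEval_injective [FiniteDimensional K F] (a : Gal(F/K) →* Perm X) :
    Function.Injective (pointEval a) := by
  classical
  intro x y hxy
  have hli := Fintype.linearIndependent_iff.1 <| (linearIndependent_toLinearMap K F F).comp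
    (fun γ : Gal(F/K) => (γ : F →ₐ[K] F)) AlgEquiv.coe_toAlgHom_injective
  let coeff (γ : Gal(F/K)) : F := (if a γ x = x then 1 else 0) - if a γ x = y then 1 else 0
  have hcoeff : coeff 1 = 0 := by
    refine hli coeff (LinearMap.ext fun c => ?_) 1
    have hc := DFunLike.congr_fun hxy ⟨_, sum_translates_mem_equivariantFunctions a x c⟩
    simpa [pointEval_apply, coeff, sub_mul, sub_eq_zero] using hc
  simpa [coeff, sub_eq_zero] using hcoeff

theorem pointEval_surjective [Finite X] [Normal K F] (a : Gal(F/K) →* Perm X) :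
    Function.Surjective (pointEval a) := by
  intro p
  have := Fintype.ofFinite X
  have hinf : Finset.univ.inf (fun x => RingHom.ker (pointEval a x)) ≤ RingHom.ker p := by
    intro φ hφ
    have hzero : φ = 0 := Subtype.ext <| funext fun x =>
      Submodule.mem_finsetInf.1 hφ x (Finset.mem_univ x)
    rw [hzero]
    exact zero_mem _
  obtain ⟨x, -, hx⟩ := (RingHom.ker_isPrime p).inf_le'.1 hinf
  obtain ⟨γ, hγ⟩ := exists_algEquiv_comp_eq_of_ker_le hx
  exact ⟨a γ x, (pointEval_action a γ x).trans hγ⟩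

/-- A finite `Gal(F/K)`-set is the set of `F`-points of its algebra of equivariant functions. -/
def pointEquiv [Finite X] [FiniteDimensional K F] [Normal K F] (a : Gal(F/K) →* Perm X) :
    X ≃ (equivariantFunctions a →ₐ[K] F) :=
  Equiv.ofBijective (pointEval a) ⟨pointEval_injective a, pointEval_surjective a⟩

theorem pointEquiv_action [Finite X] [FiniteDimensional K F] [Normal K F]
    (a : Gal(F/K) →* Perm X) (γ : Gal(F/K)) (x : X) :
    pointEquiv a (a γ x) = (γ : F →ₐ[K] F).comp (pointEquiv a x) :=
  pointEval_action a γ x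

theorem comap_piCongrLeft'_equivariantFunctions {a : Gal(F/K) →* Perm X}
    {b : Gal(F/K) →* Perm Y} {ψ : X ≃ Y} (hψ : ∀ γ x, ψ (a γ x) = b γ (ψ x)) :
    (equivariantFunctions b).comap (AlgEquiv.piCongrLeft' K (fun _ => F) ψ).toAlgHom =
      equivariantFunctions a := by
  ext φ
  have hψ_symm : ∀ γ y, ψ.symm (b γ y) = a γ (ψ.symm y) := fun γ y => by
    rw [Equiv.symm_apply_eq, hψ, Equiv.apply_symm_apply]
  simp [mem_equivariantFunctions, hψ_symm, ψ.symm.forall_congr_left]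

theorem nonempty_algEquiv_equivariantFunctions_iff [Finite X] [Finite Y] [FiniteDimensional K F]
    [Normal K F] (a : Gal(F/K) →* Perm X) (b : Gal(F/K) →* Perm Y) :
    Nonempty (equivariantFunctions a ≃ₐ[K] equivariantFunctions b) ↔ IsoAsSets a b := by
  constructor
  · rintro ⟨θ⟩
    refine ⟨(pointEquiv a).trans ((θ.arrowCongr AlgEquiv.refl).trans (pointEquiv b).symm),
      fun γ x => ?_⟩
    simp only [Equiv.trans_apply]
    rw [Equiv.symm_apply_eq, pointEquiv_action, pointEquiv_action, Equiv.apply_symm_apply]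
    rfl
  · rintro ⟨ψ, hψ⟩
    rw [← comap_piCongrLeft'_equivariantFunctions hψ]
    let e := AlgEquiv.piCongrLeft' K (fun _ => F) ψ
    exact ⟨comapEquiv e.injective fun y _ => e.surjective y⟩

end EquivariantFunctions

section CharacterTransform

variable {F N : Type*} [Field F] [Monoid N]

/-- The discrete Fourier transform on `F[N]`: evaluation at all characters `N →* Fˣ`. -/
def characterTransform (F N : Type*) [Field F] [Monoid N] :
    MonoidAlgebra F N →ₐ[F] ((N →* Fˣ) → F) :=
  AlgHom.pi fun χ => MonoidAlgebra.lift F F N ((Units.coeHom F).comp χ)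

theorem characterTransform_single (η : N) (c : F) (χ : N →* Fˣ) :
    characterTransform F N (MonoidAlgebra.single η c) χ = c * χ η := by
  simp [characterTransform]

theorem characterTransform_apply [Fintype N] (x : MonoidAlgebra F N) (χ : N →* Fˣ) :
    characterTransform F N x χ = ∑ η, x.coeff η * χ η := by
  simp [characterTransform, MonoidAlgebra.lift_apply, Finsupp.sum_fintype]

theorem linearIndependent_characters :
    LinearIndependent F fun (χ : N →* Fˣ) (η : N) => (χ η : F) :=
  (linearIndependent_monoidHom N F).comp (fun χ : N →* Fˣ => (Units.coeHom F).comp χ)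
    fun _ _ h => MonoidHom.ext fun η => Units.ext (DFunLike.congr_fun h η)

variable {A : Type*} [CommGroup A] [Finite A] [HasEnoughRootsOfUnity F (Monoid.exponent A)]

theorem span_range_characters_eq_top :
    Submodule.span F (Set.range fun (χ : A →* Fˣ) (η : A) => (χ η : F)) = ⊤ := by
  have := Fintype.ofFinite A
  have := Fintype.ofFinite (A →* Fˣ)
  refine linearIndependent_characters.span_eq_top_of_card_eq_finrank' ?_
  rw [Module.finrank_fintype_fun_eq_card, ← Nat.card_eq_fintype_card, ← Nat.card_eq_fintype_card,
    CommGroup.card_monoidHom_of_hasEnoughRootsOfUnity A F]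

theorem characterTransform_injective : Function.Injective (characterTransform F A) := by
  classical
  have := Fintype.ofFinite A
  refine (injective_iff_map_eq_zero _).2 fun x hx => ?_
  have hpairing : Fintype.linearCombination F x.coeff = 0 := by
    refine LinearMap.ext_on span_range_characters_eq_top ?_
    rintro _ ⟨χ, rfl⟩
    simpa [Fintype.linearCombination_apply, characterTransform_apply, mul_comm]
      using congrFun hx χ
  ext η
  simpa using LinearMap.congr_fun hpairing (Pi.single η 1)

theorem characterTransform_surjective : Function.Surjective (characterTransform F A) := by
  have := Fintype.ofFinite (A →* Fˣ)
  have : FiniteDimensional F (MonoidAlgebra F A) := .of_basis (MonoidAlgebra.basis A F)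
  refine (LinearMap.injective_iff_surjective_of_finrank_eq_finrank
    (f := (characterTransform F A).toLinearMap) ?_).1 characterTransform_injective
  rw [Module.finrank_eq_nat_card_basis (MonoidAlgebra.basis A F),
    Module.finrank_fintype_fun_eq_card, ← Nat.card_eq_fintype_card,
    CommGroup.card_monoidHom_of_hasEnoughRootsOfUnity A F]

end CharacterTransform

section FixedPoints

variable {K E F M M' N : Type*} [Field K] [Field E] [Field F] [Algebra K E] [Algebra K F]
  [Group M] [Group M'] [CommGroup N]

theorem coeff_galAct (f : Gal(E/K) →* MulAut M) (σ : Gal(E/K)) (x : MonoidAlgebra E M) (η : M) :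
    (galAct f σ x).coeff η = σ (x.coeff ((f σ)⁻¹ η)) := by
  simp [galAct]

theorem galAct_domCongr {f : Gal(E/K) →* MulAut M} {f' : Gal(E/K) →* MulAut M'} {e : M ≃* M'}
    (he : ∀ σ η, e (f σ η) = f' σ (e η)) (σ : Gal(E/K)) (x : MonoidAlgebra E M) :
    galAct f' σ (MonoidAlgebra.domCongr K E e x) = MonoidAlgebra.domCongr K E e (galAct f σ x) := by
  induction x using MonoidAlgebra.induction_linear with
  | zero => simp
  | add x y hx hy => simp only [map_add, hx, hy]
  | single η c => simp [galAct_single, he]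

theorem comap_domCongr_fixedPoints {f : Gal(E/K) →* MulAut M} {f' : Gal(E/K) →* MulAut M'}
    {e : M ≃* M'} (he : ∀ σ η, e (f σ η) = f' σ (e η)) :
    (fixedPoints f').comap (MonoidAlgebra.domCongr K E e).toAlgHom = fixedPoints f := by
  ext x
  simp [mem_fixedPoints, galAct_domCongr he]

theorem characterTransform_galAct (f : Gal(F/K) →* MulAut N) (γ : Gal(F/K))
    (x : MonoidAlgebra F N) (χ : N →* Fˣ) :
    characterTransform F N (galAct f γ x) (dualAction f γ χ) =
      γ (characterTransform F N x χ) := by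
  induction x using MonoidAlgebra.induction_linear with
  | zero => simp
  | add x y hx hy => simp only [map_add, Pi.add_apply, hx, hy]
  | single η c => simp [galAct_single, characterTransform_single, dualAction_apply]

theorem comap_characterTransform_equivariantFunctions [Finite N]
    [HasEnoughRootsOfUnity F (Monoid.exponent N)] (f : Gal(F/K) →* MulAut N) :
    (equivariantFunctions (dualAction f)).comap ((characterTransform F N).restrictScalars K) =
      fixedPoints f := by
  ext x
  simp only [Subalgebra.mem_comap, mem_equivariantFunctions, mem_fixedPoints,
    AlgHom.restrictScalars_apply]
  refine forall_congr' fun γ => ?_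
  rw [eq_comm (b := x), ← characterTransform_injective.eq_iff, funext_iff]
  simpa only [characterTransform_galAct] using (dualAction f γ).forall_congr_right
    (q := fun χ => characterTransform F N x χ = characterTransform F N (galAct f γ x) χ)

/-- The restriction of the character transform to an isomorphism from `F[N]^Γ`, `Γ = Gal(F/K)`,
onto the equivariant functions on the dual group. -/
def fixedPointsEquivEquivariantFunctions [Finite N] [HasEnoughRootsOfUnity F (Monoid.exponent N)]
    (f : Gal(F/K) →* MulAut N) :
    fixedPoints f ≃ₐ[K] equivariantFunctions (dualAction f) :=
  (Subalgebra.equivOfEq _ _ (comap_characterTransform_equivariantFunctions f).symm).trans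
    (comapEquiv (e := (characterTransform F N).restrictScalars K)
      (characterTransform_injective (F := F)) fun φ _ => characterTransform_surjective φ)

end FixedPoints

section Descent

variable {K E F M : Type*} [Field K] [Field E] [Field F] [Algebra K E] [Algebra K F]
  [Algebra E F] [IsScalarTower K E F]

variable (K E F) in
/-- The extension of scalars `E[M] → F[M]`. -/
abbrev extendScalars (M : Type*) [Monoid M] : MonoidAlgebra E M →ₐ[K] MonoidAlgebra F M :=
  MonoidAlgebra.mapAlgHom M (IsScalarTower.toAlgHom K E F)

theorem extendScalars_injective [Monoid M] : Function.Injective (extendScalars K E F M) :=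
  MonoidAlgebra.map_injective (algebraMap E F : E →+ F) (algebraMap E F).injective

variable [Group M] [Normal K E]

/-- The inflation to `Gal(F/K)` of an action of `Gal(E/K)`. -/
abbrev inflate (F : Type*) [Field F] [Algebra K F] [Algebra E F] [IsScalarTower K E F]
    (f : Gal(E/K) →* MulAut M) : Gal(F/K) →* MulAut M :=
  f.comp (AlgEquiv.restrictNormalHom (F := K) (K₁ := F) E)

theorem algebraMap_restrictNormalHom (γ : Gal(F/K)) (c : E) :
    algebraMap E F (AlgEquiv.restrictNormalHom E γ c) = γ (algebraMap E F c) :=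
  AlgEquiv.restrictNormal_commutes γ E c

theorem restrictNormalHom_restrictScalars (τ : Gal(F/E)) :
    AlgEquiv.restrictNormalHom E (τ.restrictScalars K) = 1 := by
  ext c
  apply (algebraMap E F).injective
  rw [algebraMap_restrictNormalHom]
  exact τ.commutes c

theorem galAct_extendScalars (f : Gal(E/K) →* MulAut M) (γ : Gal(F/K)) (x : MonoidAlgebra E M) :
    galAct (inflate F f) γ (extendScalars K E F M x) =
      extendScalars K E F M (galAct f (AlgEquiv.restrictNormalHom E γ) x) := by
  induction x using MonoidAlgebra.induction_linear with
  | zero => simp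
  | add x y hx hy => simp only [map_add, hx, hy]
  | single η c => simp [galAct_single, algebraMap_restrictNormalHom]

theorem comap_extendScalars_fixedPoints [Normal K F] (f : Gal(E/K) →* MulAut M) :
    (fixedPoints (inflate F f)).comap (extendScalars K E F M) = fixedPoints f := by
  ext x
  rw [Subalgebra.mem_comap, mem_fixedPoints, mem_fixedPoints,
    (AlgEquiv.restrictNormalHom_surjective (F := K) (K₁ := E) F).forall]
  simp only [galAct_extendScalars, (extendScalars_injective (K := K)).eq_iff]

theorem fixedPoints_inflate_le_range_extendScalars [IsGalois K F] (f : Gal(E/K) →* MulAut M) :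
    fixedPoints (inflate F f) ≤ (extendScalars K E F M).range := by
  intro x hx
  have : IsGalois E F := IsGalois.tower_top_of_isGalois K E F
  have hcoeff : ∀ η, x.coeff η ∈ Set.range (algebraMap E F) := fun η =>
    (InfiniteGalois.mem_range_algebraMap_iff_fixed _).2 fun τ => by
      have hτ := (mem_fixedPoints _ x).1 hx (τ.restrictScalars K)
      simpa [coeff_galAct, restrictNormalHom_restrictScalars] using
        congrArg (fun y => y.coeff η) hτ
  exact (MonoidAlgebra.range_map (algebraMap E F : E →+ F)).ge hcoeff

/-- Galois descent for the group algebra: `E[M]^G ≃ F[M]^Γ` for `G = Gal(E/K)` and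
`Γ = Gal(F/K)`. -/
def fixedPointsInflateEquiv [IsGalois K F] (f : Gal(E/K) →* MulAut M) :
    fixedPoints f ≃ₐ[K] fixedPoints (inflate F f) :=
  (Subalgebra.equivOfEq _ _ (comap_extendScalars_fixedPoints f).symm).trans
    (comapEquiv extendScalars_injective (fixedPoints_inflate_le_range_extendScalars f))

theorem nonempty_algEquiv_fixedPoints_iff {N₁ N₂ : Type*} [CommGroup N₁] [CommGroup N₂]
    [Finite N₁] [Finite N₂] [HasEnoughRootsOfUnity F (Monoid.exponent N₁)]
    [HasEnoughRootsOfUnity F (Monoid.exponent N₂)] [FiniteDimensional K F] [IsGalois K F]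
    (f₁ : Gal(E/K) →* MulAut N₁) (f₂ : Gal(E/K) →* MulAut N₂) :
    Nonempty (fixedPoints f₁ ≃ₐ[K] fixedPoints f₂) ↔
      IsoAsSets (dualAction (inflate F f₁)) (dualAction (inflate F f₂)) := by
  rw [← nonempty_algEquiv_equivariantFunctions_iff]
  exact (AlgEquiv.equivCongr
    ((fixedPointsInflateEquiv f₁).trans (fixedPointsEquivEquivariantFunctions _))
    ((fixedPointsInflateEquiv f₂).trans (fixedPointsEquivEquivariantFunctions _))).nonempty_congr

end Descent

namespace RegularStableEmbedding

section Group

variable {G : Type*} [Group G] {H : Subgroup G} [Finite (G ⧸ H)] {N : Type*} [Group N]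

theorem finite (α : RegularStableEmbedding G H N) : Finite N :=
  Finite.of_equiv _ α.baseEquiv.symm

theorem hom_apply_baseEquiv (α : RegularStableEmbedding G H N) (η x : N) :
    α.hom η (α.baseEquiv x) = α.baseEquiv (η * x) := by
  simp [baseEquiv]

theorem baseEquiv_beta (α : RegularStableEmbedding G H N) (g : G) (x : N) :
    α.baseEquiv ((α.beta g : Perm N) x) = cosetTranslation G H g (α.baseEquiv x) := by
  simp [beta]

theorem hom_autAction (α : RegularStableEmbedding G H N) (g : G) (η : N) :
    α.hom (α.autAction g η) =
      cosetTranslation G H g * α.hom η * (cosetTranslation G H g)⁻¹ := by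
  rw [eq_mul_inv_iff_mul_eq]
  ext y
  obtain ⟨x, rfl⟩ := α.baseEquiv.surjective y
  rw [Perm.mul_apply, Perm.mul_apply, hom_apply_baseEquiv, ← baseEquiv_beta, ← baseEquiv_beta,
    hom_apply_baseEquiv, Hol.apply_mul]
  rfl

theorem ofInjective_autAction (α : RegularStableEmbedding G H N) (g : G) (η : N) :
    MonoidHom.ofInjective α.injective (α.autAction g η) =
      α.conjAction g (MonoidHom.ofInjective α.injective η) :=
  Subtype.ext (α.hom_autAction g η)

end Group

/-- The isomorphism `E[N]^G ≃ E[α(N)]^G` induced by `α`. -/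
def fixedPointsEquiv {K E N : Type*} [Field K] [Field E] [Algebra K E] [Group N]
    {H : Subgroup Gal(E/K)} [Finite (Gal(E/K) ⧸ H)] (α : RegularStableEmbedding Gal(E/K) H N) :
    fixedPoints α.autAction ≃ₐ[K] fixedPoints α.conjAction :=
  let e := MonoidAlgebra.domCongr K E (MonoidHom.ofInjective α.injective)
  (Subalgebra.equivOfEq _ _ (comap_domCongr_fixedPoints α.ofInjective_autAction).symm).trans <|
    comapEquiv e.injective fun y _ => e.surjective y

end RegularStableEmbedding

section Compositum

open IntermediateField

variable {K E F : Type*} [Field K] [Field E] [Field F] [Algebra K E] [Algebra K F]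

theorem isGalois_of_sup_eq_top {A B : IntermediateField K F} [IsGalois K A] [IsGalois K B]
    (h : A ⊔ B = ⊤) : IsGalois K F := by
  have hsep : Algebra.IsSeparable K ↥(A ⊔ B) := inferInstance
  have hnormal := normal_sup K F A B
  rw [h] at hsep hnormal
  have : IsGalois K (⊤ : IntermediateField K F) := ⟨⟩
  exact IsGalois.of_algEquiv topEquiv

theorem finiteDimensional_of_sup_eq_top {A B : IntermediateField K F} [FiniteDimensional K A]
    [FiniteDimensional K B] (h : A ⊔ B = ⊤) : FiniteDimensional K F := by
  have hfin := finiteDimensional_sup A B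
  rw [h] at hfin
  exact topEquiv.toLinearEquiv.finiteDimensional

theorem finiteDimensional_isGalois_of_fieldRange_sup_adjoin_eq_top [FiniteDimensional K E]
    [IsGalois K E] (ι : E →ₐ[K] F) {n : ℕ} [NeZero n] {ζ : F} (hζ : IsPrimitiveRoot ζ n)
    (h : ι.fieldRange ⊔ adjoin K {ζ} = ⊤) : FiniteDimensional K F ∧ IsGalois K F := by
  let e : E ≃ₐ[K] ι.fieldRange := AlgEquiv.ofInjectiveField ι
  have : FiniteDimensional K ι.fieldRange := e.toLinearEquiv.finiteDimensional
  have : IsGalois K ι.fieldRange := IsGalois.of_algEquiv e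
  have : FiniteDimensional K (adjoin K {ζ}) :=
    adjoin.finiteDimensional ((hζ.isIntegral (NeZero.pos n)).tower_top)
  have : FiniteDimensional K F := finiteDimensional_of_sup_eq_top h
  have := hζ.intermediateField_adjoin_isCyclotomicExtension K
  have : IsGalois K (adjoin K {ζ}) := IsCyclotomicExtension.isGalois {n} K _
  exact ⟨‹_›, isGalois_of_sup_eq_top h⟩

end Compositum

end HopfGalois

end

open HopfGalois in
theorem mainTheorem5_general {K E F N₁ N₂ : Type*} [Field K] [Field E] [Field F] [Algebra K E]
    [Algebra K F] [Algebra E F] [IsScalarTower K E F] [FiniteDimensional K E] [Normal K E]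
    [FiniteDimensional K F] [IsGalois K F] [CommGroup N₁] [CommGroup N₂]
    [HasEnoughRootsOfUnity F (Monoid.exponent N₁)] [HasEnoughRootsOfUnity F (Monoid.exponent N₂)]
    {H₁ H₂ : Subgroup Gal(E/K)} (α₁ : RegularStableEmbedding Gal(E/K) H₁ N₁)
    (α₂ : RegularStableEmbedding Gal(E/K) H₂ N₂) :
    Nonempty (fixedPoints α₁.conjAction ≃ₐ[K] fixedPoints α₂.conjAction) ↔
      IsoAsSets (dualAction (inflate F α₁.autAction)) (dualAction (inflate F α₂.autAction)) := by
  have := α₁.finite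
  have := α₂.finite
  rw [← nonempty_algEquiv_fixedPoints_iff]
  exact (AlgEquiv.equivCongr α₁.fixedPointsEquiv α₂.fixedPointsEquiv).nonempty_congr.symm

open HopfGalois in
theorem mainTheorem5
    {K L E F N : Type*} [Field K] [CharZero K] [Field L] [Field E] [Field F]
    [Algebra K L] [Algebra K E] [Algebra L E] [IsScalarTower K L E]
    [Algebra K F] [Algebra E F] [IsScalarTower K E F]
    -- `L/K` is a finite (separable) extension, with Galois closure `E`
    [FiniteDimensional K L] [FiniteDimensional K E] [IsGalois K E] [IsNormalClosure K L E]
    [CommGroup N]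
    -- two embeddings of `N` into `Perm (Gal(E/K) ⧸ Gal(E/L))` with regular `G`-stable image
    (α₁ α₂ : RegularStableEmbedding Gal(E/K) (galSubgroup K L E) N)
    -- `F` is the compositum of `E` and `K(ζ)`, `ζ` a primitive root of unity of order `exp N`
    (ζ : F) (hζ : IsPrimitiveRoot ζ (Monoid.exponent N))
    (hF : (IsScalarTower.toAlgHom K E F).fieldRange ⊔ IntermediateField.adjoin K {ζ} = ⊤) :
    Nonempty (fixedPoints α₁.conjAction ≃ₐ[K] fixedPoints α₂.conjAction) ↔
      IsoAsSets
        (dualAction (α₁.autAction.comp (AlgEquiv.restrictNormalHom (F := K) (K₁ := F) E)))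
        (dualAction (α₂.autAction.comp (AlgEquiv.restrictNormalHom (F := K) (K₁ := F) E))) := by
  have := α₁.finite
  have : HasEnoughRootsOfUnity F (Monoid.exponent N) := ⟨⟨ζ, hζ⟩, rootsOfUnity.isCyclic F _⟩
  obtain ⟨_, _⟩ := finiteDimensional_isGalois_of_fieldRange_sup_adjoin_eq_top _ hζ hF
  exact mainTheorem5_general α₁ α₂
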